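/- Let $d,n\ge 1$ and let $M=(m_{ij})\in\mathbb{R}^{d\times n}$. A real $r\times r$ matrix $A=(a_{ij})$ is called tropically non-singular if the minimum of $\sum_{i=1}^r a_{i\sigma(i)}$ over all permutations $\sigma\in\mathcal S_r$ is attained by exactly one $\sigma$, and the tropical rank of $M$ is the largest $r$ such that $M$ has a tropically non-singular $r\times r$ minor (submatrix). The tropical convex hull $P$ of the columns of $M$ is the image in $\mathbb{TP}^{d-1}=\mathbb{R}^d/\mathbb{R}(1,\dots,1)$ of the set of all tropical linear combinations of the columns of $M$, that is, of all vectors $x\in\mathbb{R}^d$ of the form $x_i=\min_{1\le j\le n}(c_j+m_{ij})$ $(1\le i\le d)$ with $c\in\mathbb{R}^n$. It is a finite union of convex polytopes; its dimension $\dim P$ is the largest dimension of a nonempty convex set contained in $P$ (equivalently, the largest dimension of a cell in a finite polyhedral decomposition of $P$). Then $$\text{tropical rank}(M)=1+\dim P.$$ -/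

import Mathlib

/-- The tropical determinant of a square real matrix: the minimum over all permutations `σ`
of `m_{1 σ(1)} + ⋯ + m_{r σ(r)}`. -/
noncomputable def tropicalDet {r : ℕ} (A : Matrix (Fin r) (Fin r) ℝ) : ℝ :=
  (Finset.univ : Finset (Equiv.Perm (Fin r))).inf' Finset.univ_nonempty
    (fun σ => ∑ i, A i (σ i))

/-- A square matrix is tropically singular if the minimum defining its tropical determinant is
attained at least twice. -/
def TropicallySingular {r : ℕ} (A : Matrix (Fin r) (Fin r) ℝ) : Prop :=
  ∃ σ τ : Equiv.Perm (Fin r), σ ≠ τ ∧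
    ∑ i, A i (σ i) = tropicalDet A ∧ ∑ i, A i (τ i) = tropicalDet A

/-- The tropical rank of a `d × n` matrix: the largest `r` such that some `r × r` minor (given by
a choice of `r` distinct rows and `r` distinct columns) is tropically non-singular. The set of
such `r` contains `0` and is bounded by `d` and `n`, so the supremum is a maximum. -/
noncomputable def tropicalRank {d n : ℕ} (M : Matrix (Fin d) (Fin n) ℝ) : ℕ :=
  sSup {r : ℕ | ∃ (f : Fin r ↪ Fin d) (g : Fin r ↪ Fin n),
    ¬ TropicallySingular (M.submatrix f g)}

/-- Tropical projective space `TP^{d-1} = ℝ^d / ℝ(1,…,1)`, a real vector space. -/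
abbrev TropicalProjectiveSpace (d : ℕ) : Type :=
  (Fin d → ℝ) ⧸ Submodule.span ℝ {(fun _ => 1 : Fin d → ℝ)}

/-- The tropical linear combination `c₁ ⊙ M₁ ⊕ ⋯ ⊕ cₙ ⊙ Mₙ` of the columns of `M`
(with `⊕ = min` and `⊙ = +`). -/
noncomputable def tropicalCombination {d n : ℕ} [NeZero n] (M : Matrix (Fin d) (Fin n) ℝ)
    (c : Fin n → ℝ) : Fin d → ℝ :=
  fun i => (Finset.univ : Finset (Fin n)).inf' Finset.univ_nonempty (fun j => c j + M i j)

/-- The tropical convex hull of the columns of `M`: the image in `TP^{d-1}` of the set of all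
tropical linear combinations of the columns. -/
def tropicalConvexHull {d n : ℕ} [NeZero n] (M : Matrix (Fin d) (Fin n) ℝ) :
    Set (TropicalProjectiveSpace d) :=
  {p | ∃ c : Fin n → ℝ, p = Submodule.Quotient.mk (tropicalCombination M c)}

/-- The dimension of a nonempty polyhedral set (the union of the cells of a finite polyhedral
complex) `P` in a finite-dimensional real vector space: the largest dimension of a nonempty convex
set contained in `P`, where the dimension of a convex set is that of its affine span. For the union
of finitely many polyhedra this is the largest dimension of one of these polyhedra, because a convex
set covered by finitely many affine subspaces lies in one of them. -/
noncomputable def polyhedralDim {E : Type*} [AddCommGroup E] [Module ℝ E] (P : Set E) : ℕ :=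
  sSup {k : ℕ | ∃ C : Set E, C.Nonempty ∧ Convex ℝ C ∧ C ⊆ P ∧
    Module.finrank ℝ (vectorSpan ℝ C) = k}

/-! Both inequalities read the dimension off the positions where the minima `x i = min_j (c j + M i
j)` are attained. If a minor is non-singular, its optimal permutation is unique, and Birkhoff's
theorem with Hahn–Banach separation gives strict dual potentials (`exists_strict_potential`).
Strictness is open, so the `r` potentials vary freely and parametrize points of the hull; passing to
the quotient costs at most one dimension. Conversely, while the attaining positions stay fixed, two
rows sharing an attaining column move together, so the dimension upstairs is at most the number of
classes of linked rows. One row per class, with an attaining column for each, forms a non-singular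
minor. Each direction involves finitely many attainment patterns; the covering lemma below selects a
single one. -/

/-- A nonempty convex set covered by finitely many affine subspaces lies in one of them. -/
theorem Convex.exists_subset_affineSubspace_of_subset_biUnion {E : Type*} [AddCommGroup E]
    [Module ℝ E] {C : Set E} (hC : Convex ℝ C) (hne : C.Nonempty)
    (s : Finset (AffineSubspace ℝ E)) (hs : ∀ x ∈ C, ∃ A ∈ s, x ∈ A) :
    ∃ A ∈ s, C ⊆ A := by
  classical
  induction s using Finset.induction_on with
  | empty =>
    obtain ⟨x, hx⟩ := hne
    simpa using hs x hx
  | insert A s _ ih =>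
    by_cases hA : C ⊆ A
    · exact ⟨A, Finset.mem_insert_self A s, hA⟩
    by_cases hcov : ∀ x ∈ C, ∃ B ∈ s, x ∈ B
    · obtain ⟨B, hB, hCB⟩ := ih hcov
      exact ⟨B, Finset.mem_insert_of_mem hB, hCB⟩
    exfalso
    obtain ⟨y, hy, hyA⟩ := Set.not_subset.1 hA
    push Not at hcov
    obtain ⟨x, hx, hxs⟩ := hcov
    have hseg : ∀ t : Set.Icc (0 : ℝ) 1, ∃ B : (insert A s : Finset (AffineSubspace ℝ E)),
        AffineMap.lineMap x y (t : ℝ) ∈ (B : AffineSubspace ℝ E) := fun t => by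
      obtain ⟨B, hB, h⟩ := hs _ (hC.lineMap_mem hx hy t.2)
      exact ⟨⟨B, hB⟩, h⟩
    choose B hB using hseg
    have : Infinite (Set.Icc (0 : ℝ) 1) := (Set.Icc_infinite zero_lt_one).to_subtype
    obtain ⟨t, t', htt, hBt⟩ := Finite.exists_ne_map_eq_of_infinite B
    have hline : ∀ z : ℝ, AffineMap.lineMap x y z ∈ (B t : AffineSubspace ℝ E) := fun z => by
      have htt' : (t' : ℝ) - t ≠ 0 := sub_ne_zero.2 fun h => htt (Subtype.ext h.symm)
      have h := AffineMap.lineMap_mem ((z - t) / (t' - t)) (hB t) (hBt ▸ hB t')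
      convert h using 1
      rw [← AffineMap.apply_lineMap, AffineMap.lineMap_apply_ring']
      congr 1
      field_simp
      ring
    have hxB := hline 0
    have hyB := hline 1
    rw [AffineMap.lineMap_apply_zero] at hxB
    rw [AffineMap.lineMap_apply_one] at hyB
    rcases Finset.mem_insert.1 (B t).2 with h | h
    · exact hyA (h ▸ hyB)
    · exact hxs _ h hxB

/-! ### Strict duality for the assignment problem -/

/-- If the identity is the only permutation of minimal cost, then every nonnegative circulation
with throughput at most one is either supported on the diagonal or has positive reduced cost. -/
theorem circulation_cost_pos {ι : Type*} [Fintype ι] [DecidableEq ι] {A Λ : Matrix ι ι ℝ}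
    (hA : ∀ σ : Equiv.Perm ι, σ ≠ 1 → ∑ i, A i i < ∑ i, A i (σ i))
    (h0 : ∀ i j, 0 ≤ Λ i j) (hbal : ∀ i, ∑ j, Λ j i = ∑ j, Λ i j) (h1 : ∀ i, ∑ j, Λ i j ≤ 1) :
    (∀ i j, i ≠ j → Λ i j = 0) ∨ 0 < ∑ i, ∑ j, Λ i j * (A i j - A j j) := by
  -- Loops fill each row sum up to 1, and balance does the same for columns. Loops have zero reduced
  -- cost, so Birkhoff's theorem applied to `D` yields the cost bound.
  set D : Matrix ι ι ℝ := Λ + Matrix.diagonal (fun i => 1 - ∑ j, Λ i j) with hD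
  have hDs : D ∈ doublyStochastic ℝ ι := by
    rw [mem_doublyStochastic_iff_sum]
    refine ⟨fun i j => ?_, fun i => ?_, fun j => ?_⟩
    · refine add_nonneg (h0 i j) ?_
      rw [Matrix.diagonal_apply]
      split_ifs
      · exact sub_nonneg.2 (h1 i)
      · exact le_rfl
    · simp [hD, Finset.sum_add_distrib, Matrix.diagonal_apply]
    · simp [hD, Finset.sum_add_distrib, Matrix.diagonal_apply, hbal]
  have hcost : ∑ i, ∑ j, D i j * A i j =
      ∑ i, A i i + ∑ i, ∑ j, Λ i j * (A i j - A j j) := by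
    have h2 : ∑ i, ∑ j, Λ i j * A j j = ∑ i, (∑ j, Λ i j) * A i i := by
      rw [Finset.sum_comm]
      exact Finset.sum_congr rfl fun i _ => by rw [← Finset.sum_mul, hbal]
    simp only [hD, Matrix.add_apply, Matrix.diagonal_apply, add_mul, ite_mul, zero_mul,
      Finset.sum_add_distrib, Finset.sum_ite_eq, Finset.mem_univ, if_true, mul_sub,
      Finset.sum_sub_distrib, h2, sub_mul, one_mul]
    ring
  obtain ⟨w, hw0, hw1, hwD⟩ := exists_eq_sum_perm_of_mem_doublyStochastic hDs
  have hcost' : ∑ i, ∑ j, D i j * A i j = ∑ σ, w σ * ∑ i, A i (σ i) := by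
    have : ∀ i j, D i j = ∑ σ, w σ * if σ i = j then 1 else 0 := fun i j => by
      rw [← hwD, Matrix.sum_apply]
      simp [Equiv.Perm.permMatrix, PEquiv.toMatrix_apply, eq_comm]
    simp only [this, Finset.sum_mul, Finset.mul_sum]
    have hin : ∀ i, ∑ j, ∑ σ, w σ * (if σ i = j then 1 else 0) * A i j
        = ∑ σ, w σ * A i (σ i) := fun i => by
      rw [Finset.sum_comm]
      simp
    simp only [hin]
    exact Finset.sum_comm
  by_cases hw : ∃ σ, σ ≠ 1 ∧ 0 < w σ
  · right
    obtain ⟨τ, hτ, hwτ⟩ := hw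
    have : ∑ σ, w σ * ∑ i, A i i < ∑ σ, w σ * ∑ i, A i (σ i) := by
      refine Finset.sum_lt_sum (fun σ _ => ?_) ⟨τ, Finset.mem_univ _, ?_⟩
      · by_cases hσ : σ = 1
        · simp [hσ]
        · exact mul_le_mul_of_nonneg_left (hA σ hσ).le (hw0 σ)
      · exact mul_lt_mul_of_pos_left (hA τ hτ) hwτ
    rw [← Finset.sum_mul, hw1, one_mul, ← hcost', hcost] at this
    linarith
  · left
    intro i j hij
    push Not at hw
    have hDij : D i j = 0 := by
      rw [← hwD, Matrix.sum_apply]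
      refine Finset.sum_eq_zero fun σ _ => ?_
      by_cases hσ : σ = 1
      · simp [hσ, hij]
      · simp [le_antisymm (hw σ hσ) (hw0 σ)]
    simpa [hD, Matrix.diagonal_apply_ne _ hij] using hDij

/-- If the identity is the only permutation of minimal cost, then the linear program dual to the
assignment problem has a solution with strict inequalities off the diagonal. -/
theorem exists_strict_potential {ι : Type*} [Fintype ι] [DecidableEq ι] {A : Matrix ι ι ℝ}
    (hA : ∀ σ : Equiv.Perm ι, σ ≠ 1 → ∑ i, A i i < ∑ i, A i (σ i)) :
    ∃ u : ι → ℝ, ∀ i j, i ≠ j → u i < u j + (A i j - A j j) := by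
  rcases isEmpty_or_nonempty ι with _ | ⟨⟨k⟩⟩
  · exact ⟨0, fun i => isEmptyElim i⟩
  -- If 0 were a convex combination of the `v p`, the weights would form a circulation of total cost
  -- 0. The value 1 on loops excludes diagonal circulations and forces `0 < f (0, 1)` below.
  let w : ι × ι → ℝ := fun p => if p.1 = p.2 then 1 else A p.1 p.2 - A p.2 p.2
  let v : ι × ι → (ι → ℝ) × ℝ := fun p => (Pi.single p.2 1 - Pi.single p.1 1, w p)
  let L : (ι × ι → ℝ) →ₗ[ℝ] (ι → ℝ) × ℝ := Fintype.linearCombination ℝ v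
  let K : Set ((ι → ℝ) × ℝ) := L '' stdSimplex ℝ (ι × ι)
  have hKc : IsCompact K :=
    (isCompact_stdSimplex ℝ _).image (LinearMap.continuous_of_finiteDimensional L)
  have hKv : Convex ℝ K := (convex_stdSimplex ℝ _).linear_image L
  have h0 : (0 : (ι → ℝ) × ℝ) ∉ K := by
    rintro ⟨Λ, ⟨hΛ0, hΛ1⟩, hL⟩
    have hL' : ∑ p, Λ p • v p = 0 := by
      rw [← hL, Fintype.linearCombination_apply]
    have hbal : ∀ i, ∑ j, Λ (j, i) = ∑ j, Λ (i, j) := fun i => by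
      have := congrFun (congrArg Prod.fst hL') i
      simp [v, Prod.fst_sum, Fintype.sum_prod_type, Pi.single_apply, mul_sub,
        Finset.sum_sub_distrib] at this
      linarith
    have hcost : ∑ i, ∑ j, Λ (i, j) * w (i, j) = 0 := by
      have := congrArg Prod.snd hL'
      simpa [v, Prod.snd_sum, Fintype.sum_prod_type] using this
    rw [Fintype.sum_prod_type] at hΛ1
    have hle : ∀ i, ∑ j, Λ (i, j) ≤ 1 := fun i => by
      rw [← hΛ1]
      exact Finset.single_le_sum (f := fun i => ∑ j, Λ (i, j))
        (fun i _ => Finset.sum_nonneg fun j _ => hΛ0 _) (Finset.mem_univ i)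
    rcases circulation_cost_pos (Λ := fun i j => Λ (i, j)) hA (fun i j => hΛ0 _) hbal hle
      with h | h
    · have : ∑ i, ∑ j, Λ (i, j) * w (i, j) = ∑ i, ∑ j, Λ (i, j) :=
        Finset.sum_congr rfl fun i _ => Finset.sum_congr rfl fun j _ => by
          by_cases hij : i = j
          · simp [w, hij]
          · simp [h i j hij]
      linarith
    · have : ∑ i, ∑ j, Λ (i, j) * (A i j - A j j) ≤ ∑ i, ∑ j, Λ (i, j) * w (i, j) :=
        Finset.sum_le_sum fun i _ => Finset.sum_le_sum fun j _ => by
          by_cases hij : i = j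
          · simp [w, hij, hΛ0]
          · simp [w, hij]
      linarith
  obtain ⟨f, s, hs, hf⟩ := geometric_hahn_banach_point_closed hKv hKc.isClosed h0
  rw [map_zero] at hs
  have hfv : ∀ p, 0 < f (v p) := fun p => by
    refine hs.trans (hf _ ⟨Pi.single p 1, single_mem_stdSimplex ℝ p, ?_⟩)
    simp [L, Fintype.linearCombination_apply_single]
  have hsplit : ∀ (x : ι → ℝ) (t : ℝ), f (x, t) = f (x, 0) + t * f (0, 1) := fun x t => by
    rw [← smul_eq_mul, ← map_smul, ← map_add]
    simp
  have hb : 0 < f (0, 1) := by simpa [v, w] using hfv (k, k)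
  refine ⟨fun i => f (Pi.single i 1, 0) / f (0, 1), fun i j hij => ?_⟩
  have h := hfv (i, j)
  have hsub : f (Pi.single j 1 - Pi.single i 1, 0)
      = f (Pi.single j 1, 0) - f (Pi.single i 1, 0) := by
    rw [← map_sub]
    simp
  simp only [v, w, if_neg hij] at h
  rw [hsplit, hsub] at h
  rw [div_add' _ _ _ hb.ne', div_lt_div_iff_of_pos_right hb]
  linarith

/-! ### Dimension and the quotient by the all-ones line -/

theorem Submodule.finrank_map_add_finrank_inf_ker {K V W : Type*} [Field K] [AddCommGroup V]
    [Module K V] [FiniteDimensional K V] [AddCommGroup W] [Module K W] (f : V →ₗ[K] W)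
    (S : Submodule K V) :
    Module.finrank K (S.map f) + Module.finrank K (S ⊓ LinearMap.ker f : Submodule K V) =
      Module.finrank K S := by
  rw [← LinearMap.finrank_range_add_finrank_ker (f.domRestrict S), LinearMap.range_domRestrict,
    LinearMap.ker_domRestrict, ← Submodule.map_comap_subtype,
    Submodule.finrank_map_subtype_eq]

theorem LinearMap.map_vectorSpan {K V W : Type*} [Field K] [AddCommGroup V] [Module K V]
    [AddCommGroup W] [Module K W] (f : V →ₗ[K] W) (s : Set V) :
    (vectorSpan K s).map f = vectorSpan K (f '' s) :=
  f.toAffineMap.map_vectorSpan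

/-- The quotient map onto tropical projective space. -/
abbrev tropicalMk (d : ℕ) : (Fin d → ℝ) →ₗ[ℝ] TropicalProjectiveSpace d :=
  Submodule.mkQ _

theorem finrank_le_finrank_map_tropicalMk_add_one {d : ℕ} (S : Submodule ℝ (Fin d → ℝ)) :
    Module.finrank ℝ S ≤ Module.finrank ℝ (S.map (tropicalMk d)) + 1 := by
  rw [← S.finrank_map_add_finrank_inf_ker (tropicalMk d), Submodule.ker_mkQ]
  gcongr
  exact (Submodule.finrank_mono inf_le_right).trans
    ((finrank_span_le_card _).trans (by simp))

theorem finrank_map_tropicalMk_add_one {d : ℕ} [NeZero d] {S : Submodule ℝ (Fin d → ℝ)}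
    (hS : (fun _ => 1) ∈ S) :
    Module.finrank ℝ (S.map (tropicalMk d)) + 1 = Module.finrank ℝ S := by
  rw [← S.finrank_map_add_finrank_inf_ker (tropicalMk d), Submodule.ker_mkQ,
    inf_eq_right.2 ((Submodule.span_singleton_le_iff_mem _ _).2 hS), finrank_span_singleton]
  exact fun h => one_ne_zero (congrFun h 0)

/-! ### Tropical combinations -/

theorem tropicalCombination_le {d n : ℕ} [NeZero n] (M : Matrix (Fin d) (Fin n) ℝ)
    (c : Fin n → ℝ) (i : Fin d) (j : Fin n) : tropicalCombination M c i ≤ c j + M i j :=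
  Finset.inf'_le _ (Finset.mem_univ j)

theorem exists_tropicalCombination_eq {d n : ℕ} [NeZero n] (M : Matrix (Fin d) (Fin n) ℝ)
    (c : Fin n → ℝ) (i : Fin d) : ∃ j, tropicalCombination M c i = c j + M i j := by
  obtain ⟨j, -, hj⟩ := Finset.exists_mem_eq_inf' Finset.univ_nonempty (fun j => c j + M i j)
  exact ⟨j, hj⟩

theorem tropicalCombination_eq {d n : ℕ} [NeZero n] {M : Matrix (Fin d) (Fin n) ℝ}
    {c : Fin n → ℝ} {i : Fin d} {j : Fin n} (h : ∀ k, c j + M i j ≤ c k + M i k) :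
    tropicalCombination M c i = c j + M i j :=
  le_antisymm (tropicalCombination_le M c i j) (Finset.le_inf' _ _ fun k _ => h k)

theorem tropicalCombination_add_const {d n : ℕ} [NeZero n] (M : Matrix (Fin d) (Fin n) ℝ)
    (c : Fin n → ℝ) (t : ℝ) :
    tropicalCombination M (fun j => c j + t) = fun i => tropicalCombination M c i + t := by
  ext i
  obtain ⟨j, hj⟩ := exists_tropicalCombination_eq M c i
  rw [hj, tropicalCombination_eq (j := j)]
  · ring
  · intro k
    have := tropicalCombination_le M c i k
    linarith

/-- A multiple of the all-ones vector is absorbed by shifting every coefficient. -/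
theorem tropicalCombination_of_mk_mem {d n : ℕ} [NeZero n] {M : Matrix (Fin d) (Fin n) ℝ}
    {x : Fin d → ℝ} (hx : tropicalMk d x ∈ tropicalConvexHull M) :
    ∃ c, x = tropicalCombination M c := by
  obtain ⟨c, hc⟩ := hx
  obtain ⟨t, ht⟩ := Submodule.mem_span_singleton.1 ((Submodule.Quotient.eq _).1 hc)
  refine ⟨fun j => c j + t, ?_⟩
  rw [tropicalCombination_add_const]
  ext i
  have := congrFun ht i
  simp at this
  linarith

/-! ### Non-singular minors and potentials -/

/-- A tropically non-singular minor has, after a permutation of its columns, the identity as its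
only permutation of minimal cost. -/
theorem exists_perm_of_not_tropicallySingular {r : ℕ} {A : Matrix (Fin r) (Fin r) ℝ}
    (hA : ¬ TropicallySingular A) :
    ∃ τ : Equiv.Perm (Fin r), ∀ σ : Equiv.Perm (Fin r), σ ≠ 1 →
      ∑ i, A i (τ i) < ∑ i, A i (τ (σ i)) := by
  obtain ⟨τ, -, hτ⟩ := Finset.exists_mem_eq_inf'
    (Finset.univ_nonempty (α := Equiv.Perm (Fin r))) (fun σ => ∑ i, A i (σ i))
  refine ⟨τ, fun σ hσ => lt_of_le_of_ne ?_ fun h => hA ⟨τ, τ * σ, ?_, hτ.symm, ?_⟩⟩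
  · rw [← hτ]
    exact Finset.inf'_le (fun σ => ∑ i, A i (σ i)) (Finset.mem_univ (τ * σ))
  · exact fun h => hσ (mul_eq_left.1 h.symm)
  · exact h.symm.trans hτ.symm

/-- A matrix that can be scaled to a nonnegative matrix whose zeros are exactly on the diagonal is
tropically non-singular. -/
theorem not_tropicallySingular_of_potential {r : ℕ} {A : Matrix (Fin r) (Fin r) ℝ}
    {x c : Fin r → ℝ} (hdiag : ∀ i, c i + A i i = x i)
    (hoff : ∀ i j, i ≠ j → x i < c j + A i j) : ¬ TropicallySingular A := by
  have hlt : ∀ σ : Equiv.Perm (Fin r), σ ≠ 1 → ∑ i, A i i < ∑ i, A i (σ i) := by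
    intro σ hσ
    obtain ⟨k, hk⟩ : ∃ k, σ k ≠ k := by
      by_contra! h
      exact hσ (Equiv.ext h)
    have h : ∑ i, x i < ∑ i, (c (σ i) + A i (σ i)) := by
      refine Finset.sum_lt_sum (fun i _ => ?_) ⟨k, Finset.mem_univ k, hoff _ _ hk.symm⟩
      by_cases hi : σ i = i
      · rw [hi, hdiag]
      · exact (hoff _ _ (Ne.symm hi)).le
    rw [Finset.sum_add_distrib, Equiv.sum_comp σ c,
      ← Finset.sum_congr rfl fun i _ => hdiag i, Finset.sum_add_distrib] at h
    linarith
  have hone : ∀ σ : Equiv.Perm (Fin r), ∑ i, A i (σ i) = tropicalDet A → σ = 1 := by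
    intro σ hσ
    by_contra hne
    have h := hlt σ hne
    rw [hσ] at h
    exact h.not_ge (Finset.inf'_le (fun σ : Equiv.Perm (Fin r) => ∑ i, A i (σ i))
      (Finset.mem_univ 1))
  rintro ⟨σ, τ, hne, hσ, hτ⟩
  exact hne ((hone σ hσ).trans (hone τ hτ).symm)

/-- Needed because `sSup` on `ℕ` takes the default value 0 on unbounded sets. -/
theorem bddAbove_finrank_convex {E : Type*} [AddCommGroup E] [Module ℝ E]
    [FiniteDimensional ℝ E] (P : Set E) :
    BddAbove {k : ℕ | ∃ C : Set E, C.Nonempty ∧ Convex ℝ C ∧ C ⊆ P ∧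
      Module.finrank ℝ (vectorSpan ℝ C) = k} := by
  refine ⟨Module.finrank ℝ E, ?_⟩
  rintro k ⟨C, -, -, -, rfl⟩
  exact Submodule.finrank_le _

theorem finrank_vectorSpan_le_polyhedralDim {E : Type*} [AddCommGroup E] [Module ℝ E]
    [FiniteDimensional ℝ E] {P C : Set E} (hne : C.Nonempty) (hC : Convex ℝ C) (hCP : C ⊆ P) :
    Module.finrank ℝ (vectorSpan ℝ C) ≤ polyhedralDim P :=
  le_csSup (bddAbove_finrank_convex P) ⟨C, hne, hC, hCP, rfl⟩

theorem exists_convex_finrank_eq_polyhedralDim {E : Type*} [AddCommGroup E] [Module ℝ E]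
    [FiniteDimensional ℝ E] {P : Set E} (hP : P.Nonempty) :
    ∃ C : Set E, C.Nonempty ∧ Convex ℝ C ∧ C ⊆ P ∧
      Module.finrank ℝ (vectorSpan ℝ C) = polyhedralDim P := by
  obtain ⟨p, hp⟩ := hP
  have hne : {k : ℕ | ∃ C : Set E, C.Nonempty ∧ Convex ℝ C ∧ C ⊆ P ∧
      Module.finrank ℝ (vectorSpan ℝ C) = k}.Nonempty :=
    ⟨_, {p}, Set.singleton_nonempty p, convex_singleton p, Set.singleton_subset_iff.2 hp, rfl⟩
  exact Nat.sSup_mem hne (bddAbove_finrank_convex P)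

/-! ### The two inequalities -/

/-- A tropically non-singular `r × r` minor yields a convex set of dimension at least `r - 1` in
the tropical convex hull. -/
theorem le_one_add_polyhedralDim_of_minor {d n r : ℕ} [NeZero n] (M : Matrix (Fin d) (Fin n) ℝ)
    (f : Fin r ↪ Fin d) (g : Fin r ↪ Fin n)
    (hfg : ∀ σ : Equiv.Perm (Fin r), σ ≠ 1 →
      ∑ i, M (f i) (g i) < ∑ i, M (f i) (g (σ i))) :
    r ≤ 1 + polyhedralDim (tropicalConvexHull M) := by
  classical
  obtain ⟨u₀, hu₀⟩ := exists_strict_potential (A := M.submatrix f g) hfg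
  -- A coefficient so large that columns outside the minor never attain the minimum in its rows near
  -- `u₀`.
  obtain ⟨B, hB⟩ : ∃ B : ℝ, ∀ i j, u₀ i < B + M (f i) j := by
    obtain ⟨B, hB⟩ := Finite.bddAbove_range fun p : Fin r × Fin n => u₀ p.1 - M (f p.1) p.2
    refine ⟨B + 1, fun i j => ?_⟩
    have : u₀ i - M (f i) j ≤ B := hB ⟨(i, j), rfl⟩
    linarith
  let c : (Fin r → ℝ) → Fin n → ℝ := fun u =>
    Function.extend g (fun i => u i - M (f i) (g i)) fun _ => B
  have hcg : ∀ u i, c u (g i) = u i - M (f i) (g i) := fun u i => g.injective.extend_apply _ _ i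
  have hcB : ∀ u j, (¬ ∃ i, g i = j) → c u j = B := fun u j hj => Function.extend_apply' _ _ j hj
  have hcomb : ∀ (u v : Fin r → ℝ) (a b : ℝ), a + b = 1 → ∀ j,
      c (a • u + b • v) j = a * c u j + b * c v j := by
    intro u v a b hab j
    by_cases hj : ∃ i, g i = j
    · obtain ⟨i, rfl⟩ := hj
      simp only [hcg, Pi.add_apply, Pi.smul_apply, smul_eq_mul]
      linear_combination M (f i) (g i) * hab
    · rw [hcB _ _ hj, hcB _ _ hj, hcB _ _ hj, ← add_mul, hab, one_mul]
  -- On `U`, column `g i` alone attains the minimum in row `f i`, so the rows of the minor recover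
  -- `u`.
  let U : Set (Fin r → ℝ) := {u | ∀ i j, g i ≠ j → u i < c u j + M (f i) j}
  have hUo : IsOpen U := by
    simp only [U, Set.ofPred_forall]
    refine isOpen_iInter_of_finite fun i => isOpen_iInter_of_finite fun j =>
      isOpen_iInter_of_finite fun _ => isOpen_lt (continuous_apply i) ?_
    refine Continuous.add ?_ continuous_const
    by_cases hj : ∃ k, g k = j
    · obtain ⟨k, rfl⟩ := hj
      simp only [hcg]
      fun_prop
    · simp only [hcB _ _ hj]
      fun_prop
  have hUc : Convex ℝ U := by
    intro u hu v hv a b ha hb hab i j hij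
    rw [hcomb u v a b hab]
    have h1 := hu i j hij
    have h2 := hv i j hij
    simp only [Pi.add_apply, Pi.smul_apply, smul_eq_mul]
    have hM : M (f i) j = a * M (f i) j + b * M (f i) j := by rw [← add_mul, hab, one_mul]
    rw [hM]
    rcases ha.eq_or_lt with rfl | ha
    · have : b = 1 := by linarith
      subst this
      linarith
    · have h3 := mul_lt_mul_of_pos_left h1 ha
      have h4 := mul_le_mul_of_nonneg_left h2.le hb
      linarith
  have hUne : u₀ ∈ U := by
    intro i j hij
    by_cases hj : ∃ k, g k = j
    · obtain ⟨k, rfl⟩ := hj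
      have := hu₀ i k fun h => hij (h ▸ rfl)
      simp only [Matrix.submatrix_apply] at this
      rw [hcg]
      linarith
    · rw [hcB _ _ hj]
      exact hB i j
  have hUf : ∀ u ∈ U, ∀ i, tropicalCombination M (c u) (f i) = u i := by
    intro u hu i
    rw [tropicalCombination_eq (j := g i), hcg, sub_add_cancel]
    intro j
    rw [hcg, sub_add_cancel]
    by_cases hij : g i = j
    · rw [← hij, hcg, sub_add_cancel]
    · exact (hu i j hij).le
  -- The pieces of `U` on which the parametrization `u ↦ tropicalCombination M (c u)` is affine.
  let X : (Fin d → Fin n) → Set (Fin r → ℝ) := fun φ =>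
    {u | u ∈ U ∧ ∀ i, tropicalCombination M (c u) i = c u (φ i) + M i (φ i)}
  -- Some piece has affine span containing the open set `U`, hence everything.
  obtain ⟨A, hA, hUA⟩ := hUc.exists_subset_affineSubspace_of_subset_biUnion ⟨u₀, hUne⟩
    (Finset.univ.image fun φ => affineSpan ℝ (X φ)) fun u hu => by
      choose φ hφ using exists_tropicalCombination_eq M (c u)
      exact ⟨_, Finset.mem_image_of_mem _ (Finset.mem_univ φ), subset_affineSpan ℝ _ ⟨hu, hφ⟩⟩
  obtain ⟨φ, -, rfl⟩ := Finset.mem_image.1 hA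
  have htop : affineSpan ℝ (X φ) = ⊤ := by
    rw [eq_top_iff, ← hUo.affineSpan_eq_top ⟨u₀, hUne⟩]
    exact affineSpan_le.2 hUA
  have hXne : (X φ).Nonempty := (affineSpan_nonempty ℝ).1 ⟨u₀, hUA hUne⟩
  let F : (Fin r → ℝ) → Fin d → ℝ := fun u => tropicalCombination M (c u)
  have hXF : ∀ u ∈ X φ, ∀ v ∈ X φ, ∀ a b : ℝ, 0 ≤ a → 0 ≤ b → a + b = 1 →
      a • u + b • v ∈ X φ ∧ F (a • u + b • v) = a • F u + b • F v := by
    intro u hu v hv a b ha hb hab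
    have key : ∀ i, F (a • u + b • v) i = c (a • u + b • v) (φ i) + M i (φ i) := by
      intro i
      refine tropicalCombination_eq fun k => ?_
      rw [hcomb u v a b hab, hcomb u v a b hab]
      have h1 := (hu.2 i).symm.trans_le (tropicalCombination_le M (c u) i k)
      have h2 := (hv.2 i).symm.trans_le (tropicalCombination_le M (c v) i k)
      have h3 := mul_le_mul_of_nonneg_left h1 ha
      have h4 := mul_le_mul_of_nonneg_left h2 hb
      have e1 : M i (φ i) = a * M i (φ i) + b * M i (φ i) := by rw [← add_mul, hab, one_mul]
      have e2 : M i k = a * M i k + b * M i k := by rw [← add_mul, hab, one_mul]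
      linarith
    refine ⟨⟨hUc hu.1 hv.1 ha hb hab, key⟩, ?_⟩
    ext i
    rw [key, hcomb u v a b hab]
    simp only [F, Pi.add_apply, Pi.smul_apply, smul_eq_mul, hu.2 i, hv.2 i]
    linear_combination -M i (φ i) * hab
  have hFc : Convex ℝ (F '' X φ) := by
    rintro _ ⟨u, hu, rfl⟩ _ ⟨v, hv, rfl⟩ a b ha hb hab
    obtain ⟨h1, h2⟩ := hXF u hu v hv a b ha hb hab
    exact ⟨_, h1, h2⟩
  have hproj : LinearMap.funLeft ℝ ℝ f '' (F '' X φ) = X φ := by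
    rw [Set.image_image]
    refine (Set.image_congr fun u hu => ?_).trans (Set.image_id' _)
    ext i
    exact hUf u hu.1 i
  have hrank : r ≤ Module.finrank ℝ (vectorSpan ℝ (F '' X φ)) := by
    refine le_trans ?_ (Submodule.finrank_map_le (LinearMap.funLeft ℝ ℝ f) _)
    rw [LinearMap.map_vectorSpan, hproj, ← direction_affineSpan, htop,
      AffineSubspace.direction_top, finrank_top, Module.finrank_fin_fun]
  have hle := finrank_le_finrank_map_tropicalMk_add_one (vectorSpan ℝ (F '' X φ))
  rw [LinearMap.map_vectorSpan] at hle
  have hdim := finrank_vectorSpan_le_polyhedralDim (P := tropicalConvexHull M)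
    ((hXne.image F).image (tropicalMk d)) (hFc.linear_image (tropicalMk d)) (by
      rintro _ ⟨_, ⟨u, -, rfl⟩, rfl⟩
      exact ⟨c u, rfl⟩)
  omega

/-- A convex set of dimension `k` in the tropical convex hull yields a tropically non-singular
minor of size `k + 1`. -/
theorem exists_minor_of_convex {d n : ℕ} [NeZero d] [NeZero n] (M : Matrix (Fin d) (Fin n) ℝ)
    {C : Set (TropicalProjectiveSpace d)} (hne : C.Nonempty) (hC : Convex ℝ C)
    (hCP : C ⊆ tropicalConvexHull M) :
    ∃ (f : Fin (Module.finrank ℝ (vectorSpan ℝ C) + 1) ↪ Fin d)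
      (g : Fin (Module.finrank ℝ (vectorSpan ℝ C) + 1) ↪ Fin n),
      ¬ TropicallySingular (M.submatrix f g) := by
  classical
  let C' : Set (Fin d → ℝ) := tropicalMk d ⁻¹' C
  have hC'c : Convex ℝ C' := hC.linear_preimage (tropicalMk d)
  have himage : tropicalMk d '' C' = C :=
    Set.image_preimage_eq C (Submodule.mkQ_surjective _)
  obtain ⟨x₀, hx₀⟩ : C'.Nonempty := Set.Nonempty.of_image (himage.symm ▸ hne)
  -- The preimage is stable under adding the all-ones vector, so the quotient loses exactly one
  -- dimension.
  have hone : (fun _ => 1 : Fin d → ℝ) ∈ vectorSpan ℝ C' := by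
    have hx₁ : (fun _ => 1) + x₀ ∈ C' := by
      have h1 : tropicalMk d (fun _ => 1) = 0 :=
        (Submodule.Quotient.mk_eq_zero _).2 (Submodule.mem_span_singleton_self _)
      rw [Set.mem_preimage, map_add, h1, zero_add]
      exact hx₀
    simpa using vsub_mem_vectorSpan ℝ hx₁ hx₀
  have hrank := finrank_map_tropicalMk_add_one hone
  rw [LinearMap.map_vectorSpan, himage] at hrank
  -- The points at which the minima are attained exactly at the positions in `G`.
  let X : (Fin d → Fin n → Prop) → Set (Fin d → ℝ) := fun G =>
    {x | ∃ c, x = tropicalCombination M c ∧ ∀ i j, G i j ↔ x i = c j + M i j}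
  obtain ⟨A, hA, hCA⟩ := hC'c.exists_subset_affineSubspace_of_subset_biUnion ⟨x₀, hx₀⟩
    (Finset.univ.image fun G => affineSpan ℝ (X G)) fun x hx => by
      obtain ⟨c, hc⟩ := tropicalCombination_of_mk_mem (hCP hx)
      exact ⟨_, Finset.mem_image_of_mem _ (Finset.mem_univ fun i j => x i = c j + M i j),
        subset_affineSpan ℝ _ ⟨c, hc, fun _ _ => Iff.rfl⟩⟩
  obtain ⟨G, -, rfl⟩ := Finset.mem_image.1 hA
  obtain ⟨x, c, hx, hG⟩ : (X G).Nonempty := (affineSpan_nonempty ℝ).1 ⟨x₀, hCA hx₀⟩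
  -- If rows `i` and `k` share column `j`, then `y i - y k = M i j - M k j` for all `y` in `X G`;
  -- differences of such points are constant on classes.
  let R : Fin d → Fin d → Prop := fun i k => ∃ j, G i j ∧ G k j
  let q : Fin d → Quot R := Quot.mk R
  have : Finite (Quot R) := Finite.of_surjective q Quot.mk_surjective
  have : Fintype (Quot R) := Fintype.ofFinite _
  have hspan : vectorSpan ℝ C' ≤ LinearMap.range (LinearMap.funLeft ℝ ℝ q) := by
    rw [← direction_affineSpan]
    refine (AffineSubspace.direction_le (affineSpan_le.2 hCA)).trans ?_
    rw [direction_affineSpan, vectorSpan_def, Submodule.span_le]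
    rintro _ ⟨y, ⟨b, -, hb⟩, z, ⟨b', -, hb'⟩, rfl⟩
    refine ⟨Quot.lift (y - z) ?_, rfl⟩
    rintro i k ⟨j, hi, hk⟩
    simp only [Pi.sub_apply]
    linarith [(hb i j).1 hi, (hb k j).1 hk, (hb' i j).1 hi, (hb' k j).1 hk]
  have hcard : Module.finrank ℝ (vectorSpan ℝ C) + 1 ≤ Fintype.card (Quot R) := by
    rw [hrank]
    refine (Submodule.finrank_mono hspan).trans ((LinearMap.finrank_range_le _).trans ?_)
    rw [Module.finrank_fintype_fun_eq_card]
  obtain ⟨e⟩ : Nonempty (Fin (Module.finrank ℝ (vectorSpan ℝ C) + 1) ↪ Quot R) :=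
    Function.Embedding.nonempty_of_card_le (by simpa using hcard)
  let f := fun a => (e a).out
  have hfR : ∀ a b, R (f a) (f b) → a = b := fun a b h => by
    have := Quot.sound h
    rw [Quot.out_eq, Quot.out_eq] at this
    exact e.injective this
  have hrow : ∀ i, ∃ j, G i j := fun i => by
    obtain ⟨j, hj⟩ := exists_tropicalCombination_eq M c i
    exact ⟨j, (hG i j).2 (hx ▸ hj)⟩
  choose t ht using hrow
  -- A repeated column, or equality off the diagonal, would link two representatives of distinct
  -- classes.
  refine ⟨⟨f, fun a b h => hfR a b ⟨t (f a), ht _, h ▸ ht _⟩⟩,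
    ⟨fun a => t (f a), fun a b (h : t (f a) = t (f b)) => hfR a b ⟨t (f a), ht _, h ▸ ht _⟩⟩,
    not_tropicallySingular_of_potential (x := fun a => x (f a)) (c := fun a => c (t (f a)))
      (fun a => ((hG _ _).1 (ht _)).symm) fun a b hab => lt_of_le_of_ne ?_ fun h => ?_⟩
  · rw [hx]
    exact tropicalCombination_le M c _ _
  · exact hab (hfR a b ⟨t (f b), (hG _ _).2 h, ht _⟩)

theorem theorem4p2 (d n : ℕ) [NeZero d] [NeZero n] (M : Matrix (Fin d) (Fin n) ℝ) :
    tropicalRank M = 1 + polyhedralDim (tropicalConvexHull M) := by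
  -- The empty minor, with its single permutation, shows that the set of sizes is nonempty.
  refine le_antisymm (csSup_le ⟨0, Function.Embedding.ofIsEmpty, Function.Embedding.ofIsEmpty,
    fun ⟨σ, τ, h, _⟩ => h (Subsingleton.elim σ τ)⟩ ?_) (le_csSup ⟨d, ?_⟩ ?_)
  · rintro r ⟨f, g, h⟩
    obtain ⟨τ, hτ⟩ := exists_perm_of_not_tropicallySingular h
    exact le_one_add_polyhedralDim_of_minor M f (τ.toEmbedding.trans g) hτ
  · rintro r ⟨f, -, -⟩
    simpa using Fintype.card_le_of_embedding f
  · obtain ⟨C, hne, hC, hCP, hdim⟩ := exists_convex_finrank_eq_polyhedralDim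
      (P := tropicalConvexHull M) ⟨_, 0, rfl⟩
    rw [add_comm, ← hdim]
    exact exists_minor_of_convex M hne hC hCP
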